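/- Let $\psi^{ijkl}\in\mathbb C$ ($i,j,k,l\in\{0,1\}$) be the amplitudes of a normalized four-qubit vector with $\psi^{ijkl}=-\psi^{klij}$, and let $\varrho=\mathrm{tr}_{34}|\psi\rangle\langle\psi|$; such two-qubit states $\varrho$ are said to have a fermionic purification. With $\varepsilon=\begin{pmatrix}0&1\\-1&0\end{pmatrix}$ and $\tilde\varrho=\overline{(\varepsilon\otimes\varepsilon)\varrho(\varepsilon\otimes\varepsilon)^\dagger}$, let $C(\varrho)=\max\{0,\lambda_1-\lambda_2-\lambda_3-\lambda_4\}$ be the Wootters concurrence, where $\lambda_1\ge\lambda_2\ge\lambda_3\ge\lambda_4$ are the eigenvalues of $\sqrt{\sqrt\varrho\,\tilde\varrho\sqrt\varrho}$, and let $N(\varrho)=\|\varrho^{t_1}\|_{\mathrm{tr}}-1$ be the negativity, where $t_1$ is the transposition on the first qubit. Put $$\ell(c)=\tfrac12\bigl(\sqrt{1+4c^2}-1\bigr),\qquad u(c)=\tfrac12\bigl(\sqrt{2-(1-2c)^2}-1\bigr).$$ (i) Every $\varrho$ with a fermionic purification satisfies $0\le C(\varrho)\le\frac12$ and $\ell(C(\varrho))\le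 N(\varrho)\le u(C(\varrho))$. (ii) Let $g(c)=\sqrt{(1-c)^2+c^2}-(1-c)$; the general two-qubit bounds of Verstraete et al. are $g(C)\le N\le C$. For $0\le c\le\frac12$ one has $g(c)\le\ell(c)$ and $u(c)\le c$; moreover $g(c)<\ell(c)$ for $0<c<\frac12$, and $u(c)<c$ for $0<c\le\frac12$. Within $[0,1]$ the inequality $g(c)\le\ell(c)$ holds only for $c\le\frac12$. (iii) For $w,z\in\mathbb C^3$ with $\|w\|^2+\|z\|^2=1$ let $\psi^{ijkl}=\frac12(\varepsilon^{ik}A^{jl}+B^{ik}\varepsilon^{jl})$ with $$A=\begin{pmatrix}z_1-iz_2&-z_3\\-z_3&-z_1-iz_2\end{pmatrix},\qquad B=\begin{pmatrix}w_1-iw_2&-w_3\\-w_3&-w_1-iw_2\end{pmatrix},$$ and let $\varrho_{w,z}=\mathrm{tr}_{34}|\psi\rangle\langle\psi|$. Then $\varrho_{w,z}$ has a fermionic purification. If $w=z$, then $N(\varrho_{w,z})=u(C(\varrho_{w,z}))$. If $\sum_i w_i^2=\sum_i z_i^2=0$, then $N(\varrho_{w,z})=\ell(C(\varrho_{w,z}))$.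 (iv) For $0\le\vartheta\le\frac\pi4$ and $0\le\varphi\le\frac\pi2$ let $\varrho_{\vartheta,\varphi}=\varrho_{w,z}$ with $w=\frac{\cos\vartheta}{\sqrt2}(1,e^{i\varphi},0)$ and $z=\frac{\sin\vartheta}{\sqrt2}(1,e^{i\varphi},0)$. These states have fermionic purifications, and $$C(\varrho_{\vartheta,\varphi})=\tfrac12\max\{0,\sin2\vartheta-\cos\varphi\},\qquad N(\varrho_{\vartheta,\varphi})=\tfrac12\max\Bigl\{0,\sqrt{\sin^2 2\vartheta+\sin^2\varphi}-1\Bigr\}.$$ For $\vartheta=\frac\pi4$ the upper bound $N=u(C)$ is attained for every $\varphi$, and for $\varphi=\frac\pi2$ the lower bound $N=\ell(C)$ is attained for every $\vartheta$; along each of these two curves $C$ takes every value in $[0,\frac12]$. Hence both bounds are tight for every admissible value of $C$. -/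

import Mathlib

noncomputable section

namespace FermionicTwoQubit

/-- Operators on the Hilbert space of two qubits, in the computational basis indexed by pairs
`(i, j)`. -/
abbrev TwoQubitOp : Type := Matrix (Fin 2 × Fin 2) (Fin 2 × Fin 2) ℂ

/-- State vectors of four qubits, given by their amplitudes `ψ i j k l`. -/
abbrev FourQubitVec : Type := Fin 2 → Fin 2 → Fin 2 → Fin 2 → ℂ

/-- The antisymmetric tensor `ε`. -/
def eps : Matrix (Fin 2) (Fin 2) ℂ := !![0, 1; -1, 0]

/-- `tr₃₄ |ψ⟩⟨ψ|`. -/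
def reducedState (ψ : FourQubitVec) : TwoQubitOp :=
  Matrix.of fun a b => ∑ k, ∑ l, ψ a.1 a.2 k l * starRingEnd ℂ (ψ b.1 b.2 k l)

/-- A two-qubit state with a fermionic purification: the reduced state of a normalized four-qubit
vector whose amplitudes are antisymmetric in the first and second pairs of indices. -/
def HasFermionicPurification (ϱ : TwoQubitOp) : Prop :=
  ∃ ψ : FourQubitVec,
    (∀ i j k l, ψ i j k l = -ψ k l i j) ∧
    (∑ i, ∑ j, ∑ k, ∑ l, ‖ψ i j k l‖ ^ 2 = 1) ∧
    ϱ = reducedState ψ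

/-- Transposition on the first qubit. -/
def partialTranspose (ϱ : TwoQubitOp) : TwoQubitOp :=
  Matrix.of fun a b => ϱ (b.1, a.2) (a.1, b.2)

open scoped MatrixOrder ComplexOrder in
/-- The trace norm `tr √(M† M)`. -/
def traceNorm (M : TwoQubitOp) : ℝ :=
  (Matrix.trace (CFC.sqrt (M.conjTranspose * M))).re

/-- The negativity, in the normalization `‖ϱ^{t₁}‖_tr - 1`. -/
def negativity (ϱ : TwoQubitOp) : ℝ :=
  traceNorm (partialTranspose ϱ) - 1

/-- The spin flip: the entrywise complex conjugate of `(ε ⊗ ε) ϱ (ε ⊗ ε)†`. -/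
def spinFlip (ϱ : TwoQubitOp) : TwoQubitOp :=
  (Matrix.kronecker eps eps * ϱ * (Matrix.kronecker eps eps).conjTranspose).map (starRingEnd ℂ)

open scoped MatrixOrder ComplexOrder in
/-- The matrix `√(√ϱ ϱ̃ √ϱ)`. -/
def woottersMatrix (ϱ : TwoQubitOp) : TwoQubitOp :=
  CFC.sqrt (CFC.sqrt ϱ * spinFlip ϱ * CFC.sqrt ϱ)

open scoped MatrixOrder ComplexOrder in
theorem woottersMatrix_isHermitian (ϱ : TwoQubitOp) : (woottersMatrix ϱ).IsHermitian :=
  (Matrix.nonneg_iff_posSemidef.mp (CFC.sqrt_nonneg _)).isHermitian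

/-- The eigenvalues of `√(√ϱ ϱ̃ √ϱ)` with multiplicity, in decreasing order
(`eigenvalues₀` is antitone). -/
def woottersEigenvalue (ϱ : TwoQubitOp) (i : Fin 4) : ℝ :=
  (woottersMatrix_isHermitian ϱ).eigenvalues₀ (Fin.cast (by simp) i)

/-- The Wootters concurrence `(λ₁ - λ₂ - λ₃ - λ₄)⁺`. -/
def concurrence (ϱ : TwoQubitOp) : ℝ :=
  max 0 (woottersEigenvalue ϱ 0 - woottersEigenvalue ϱ 1
    - woottersEigenvalue ϱ 2 - woottersEigenvalue ϱ 3)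

/-- The lower bound on the negativity in terms of the concurrence for fermionic purifications. -/
def fermionicLower (c : ℝ) : ℝ := 1 / 2 * (√(1 + (2 * c) ^ 2) - 1)

/-- The upper bound on the negativity in terms of the concurrence for fermionic purifications. -/
def fermionicUpper (c : ℝ) : ℝ := 1 / 2 * (√(2 - (1 - 2 * c) ^ 2) - 1)

/-- The lower bound of Verstraete et al. for general two-qubit states
(their upper bound is `c` itself). -/
def generalLower (c : ℝ) : ℝ := √((1 - c) ^ 2 + c ^ 2) - (1 - c)

/-- The symmetric matrix attached to a vector of `ℂ³`. -/
def symMatrix (z : Fin 3 → ℂ) : Matrix (Fin 2) (Fin 2) ℂ :=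
  !![z 0 - Complex.I * z 1, -z 2; -z 2, -z 0 - Complex.I * z 1]

/-- The antisymmetric four-qubit vector with parameters `w, z ∈ ℂ³`. -/
def fermionicVec (w z : Fin 3 → ℂ) : FourQubitVec :=
  fun i j k l => 1 / 2 * (eps i k * symMatrix z j l + symMatrix w i k * eps j l)

/-- The two-qubit state with parameters `w, z ∈ ℂ³`. -/
def fermionicState (w z : Fin 3 → ℂ) : TwoQubitOp := reducedState (fermionicVec w z)

/-- The direction `(1, e^{iφ}, 0) / √2`. -/
def direction (φ : ℝ) : Fin 3 → ℂ :=
  ((1 / √2 : ℝ) : ℂ) • ![1, Complex.exp (φ * Complex.I), 0]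

/-- The two-parameter subfamily: `w = cos ϑ (1, e^{iφ}, 0) / √2`,
`z = sin ϑ (1, e^{iφ}, 0) / √2`. -/
def twoParamState (ϑ φ : ℝ) : TwoQubitOp :=
  fermionicState ((Real.cos ϑ : ℂ) • direction φ) ((Real.sin ϑ : ℂ) • direction φ)

end FermionicTwoQubit

end

open FermionicTwoQubit

/-!
Identify a four-qubit vector with the `4 × 4` matrix `P` of its amplitudes, so that `ϱ = P P†`.
If `P` is antisymmetric, then `P = (ε ⊗ A + B ⊗ ε) / 2` with symmetric `A` and `B`
(`exists_antisymVec`). A local unitary `U ⊗ V` with `U, V ∈ SU(2)` fixes `ε` under congruence, hence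
acts by `A ↦ V A Vᵀ`, `B ↦ U B Uᵀ` (`reducedState_antisymVec_conj`), and a complex symmetric `2 × 2`
matrix is diagonalized by such a congruence (`exists_su2_diagonal`). So one may take
`B = diag(p, -q)` and `A = diag(r, -t)`. Then `ϱ` preserves the parity of the basis vectors, that is,
it has X shape. With

* `k = √((|p|² + |r|²) (|q|² + |t|²))` and `o = |p r̄ + t q̄|`,
* `k' = √((|p|² + |t|²) (|q|² + |r|²))` and `b = |p t̄ + r q̄|`,

which satisfy `b ≤ k ≤ 1` and `o ≤ k' ≤ 1`, the Wootters eigenvalues are `(k ± b) / 4` and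
`(k' ± o) / 4`, and the partial transpose has the eigenvalues `(1 ± √(1 + o² - k²)) / 4` and
`(1 ± √(1 + b² - k'²)) / 4`. Therefore (`measures_of_conj_eq_canonical`)

* `C = max {0, o - k, b - k'} / 2`,
* `N = max {0, √(1 + o² - k²) - 1, √(1 + b² - k'²) - 1} / 2`.

The inequalities above exclude `o > k` together with `b > k'`. If `o ≥ k`, then
`1 + o² - k² = 1 + 4 C² + 4 C k`, which is at least `1 + 4 C²`, with equality for `k = 0`, and at
most `2 - (1 - 2 C)²` because `2 C + k = o ≤ 1`, with equality for `o = 1`. The case `b ≥ k'` is the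
same with primed quantities, and otherwise both measures vanish. Equal parameters `w = z` give
`o = 1`; null vectors `w`, `z` mean `det A = det B = 0`, which forces `k = 0` or `k' = 0`. The
two-parameter family is in canonical form from the start, with `k = cos φ` and `o = sin 2ϑ`.

All spectra are handled through characteristic polynomials, since those of `ϱ ϱ̃` and `ϱ^{t₁}` are
invariant under local unitaries and determine both measures (`concurrence_eq_of_roots_charpoly`,
`traceNorm_eq_of_roots_charpoly`).
-/

namespace FermionicTwoQubit

open Polynomial Matrix

/-! ### Spectra of square roots -/

theorem roots_charpoly_mul_self {S : TwoQubitOp} (hS : S.IsHermitian) :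
    (S * S).charpoly.roots =
      (Finset.univ.val.map hS.eigenvalues).map fun x : ℝ => ((x ^ 2 : ℝ) : ℂ) := by
  have h : S * S = cfc (fun x : ℝ => x ^ 2) S := by
    rw [cfc_pow_id (R := ℝ) S 2 hS.isSelfAdjoint, pow_two]
  rw [h, hS.charpoly_cfc_eq, Polynomial.roots_prod]
  · simp only [roots_X_sub_C, Multiset.bind_singleton, Multiset.map_map]
    rfl
  · exact Finset.prod_ne_zero_iff.mpr fun i _ => X_sub_C_ne_zero _

open scoped ComplexOrder in
/-- The spectrum of a positive semidefinite square root is read off from the characteristic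
polynomial of the square. -/
theorem eigenvalues_eq_of_roots_charpoly_mul_self {S : TwoQubitOp} (hS : S.PosSemidef)
    {m : Multiset ℝ} (hm : ∀ x ∈ m, 0 ≤ x)
    (h : (S * S).charpoly.roots = m.map fun x : ℝ => ((x ^ 2 : ℝ) : ℂ)) :
    Finset.univ.val.map hS.isHermitian.eigenvalues = m := by
  rw [roots_charpoly_mul_self hS.isHermitian] at h
  have key : ∀ s : Multiset ℝ, (∀ x ∈ s, 0 ≤ x) →
      (s.map fun x : ℝ => ((x ^ 2 : ℝ) : ℂ)).map (fun y : ℂ => √y.re) = s := by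
    intro s hs
    rw [Multiset.map_map]
    conv_rhs => rw [← Multiset.map_id' s]
    refine Multiset.map_congr rfl fun x hx => ?_
    simp only [Function.comp_apply, Complex.ofReal_re]
    exact Real.sqrt_sq (hs x hx)
  rw [← key m hm, ← h, key]
  intro x hx
  obtain ⟨i, -, rfl⟩ := Multiset.mem_map.mp hx
  exact hS.eigenvalues_nonneg i

open scoped MatrixOrder ComplexOrder in
/-- The trace norm of a Hermitian operator is the sum of the moduli of its eigenvalues. -/
theorem traceNorm_eq_of_roots_charpoly {H : TwoQubitOp} (hH : H.IsHermitian) {m : Multiset ℝ}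
    (h : H.charpoly.roots = m.map fun x : ℝ => (x : ℂ)) :
    traceNorm H = (m.map fun x => |x|).sum := by
  have hm : Finset.univ.val.map hH.eigenvalues = m := by
    refine Multiset.map_injective Complex.ofReal_injective ?_
    rw [← h, hH.roots_charpoly_eq_eigenvalues, Multiset.map_map]
    rfl
  have hS : (CFC.sqrt (Hᴴ * H)).PosSemidef :=
    Matrix.nonneg_iff_posSemidef.mp (CFC.sqrt_nonneg _)
  have hsq : CFC.sqrt (Hᴴ * H) * CFC.sqrt (Hᴴ * H) = H * H := by
    rw [CFC.sqrt_mul_sqrt_self _ (Matrix.nonneg_iff_posSemidef.mpr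
      (Matrix.posSemidef_conjTranspose_mul_self H)), hH.eq]
  have heig := eigenvalues_eq_of_roots_charpoly_mul_self hS (m := m.map fun x => |x|)
    (by simp) (by
      rw [hsq, roots_charpoly_mul_self hH, hm, Multiset.map_map]
      simp only [Function.comp_def, sq_abs])
  rw [traceNorm, hS.isHermitian.trace_eq_sum_eigenvalues, ← heig]
  simp

open scoped MatrixOrder ComplexOrder in
/-- The operators `√(√ϱ ϱ̃ √ϱ)²` and `ϱ ϱ̃` have the same characteristic polynomial. -/
theorem charpoly_woottersMatrix_mul_self {ϱ : TwoQubitOp} (hϱ : ϱ.PosSemidef)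
    (hflip : (spinFlip ϱ).PosSemidef) :
    (woottersMatrix ϱ * woottersMatrix ϱ).charpoly = (ϱ * spinFlip ϱ).charpoly := by
  have hs : (CFC.sqrt ϱ).IsHermitian :=
    (Matrix.nonneg_iff_posSemidef.mp (CFC.sqrt_nonneg ϱ)).isHermitian
  have hpos : (CFC.sqrt ϱ * spinFlip ϱ * CFC.sqrt ϱ).PosSemidef := by
    have := hflip.mul_mul_conjTranspose_same (CFC.sqrt ϱ)
    rwa [hs.eq] at this
  rw [woottersMatrix, CFC.sqrt_mul_sqrt_self _ (Matrix.nonneg_iff_posSemidef.mpr hpos),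
    mul_assoc, Matrix.charpoly_mul_comm, mul_assoc,
    CFC.sqrt_mul_sqrt_self _ (Matrix.nonneg_iff_posSemidef.mpr hϱ), Matrix.charpoly_mul_comm]

open scoped ComplexOrder in
theorem spinFlip_posSemidef {ϱ : TwoQubitOp} (hϱ : ϱ.PosSemidef) : (spinFlip ϱ).PosSemidef := by
  have h := hϱ.mul_mul_conjTranspose_same (Matrix.kronecker eps eps)
  -- entrywise conjugation of a Hermitian matrix is transposition
  have e : spinFlip ϱ = (Matrix.kronecker eps eps * ϱ * (Matrix.kronecker eps eps)ᴴ)ᵀ := by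
    conv_rhs => rw [← h.isHermitian.eq]
    rfl
  rw [e]
  exact h.transpose

open scoped MatrixOrder ComplexOrder in
/-- The concurrence in terms of the roots of the characteristic polynomial of `ϱ ϱ̃`: only the
largest Wootters eigenvalue has to be singled out. -/
theorem concurrence_eq_of_roots_charpoly {ϱ : TwoQubitOp} (hϱ : ϱ.PosSemidef) {a b c d : ℝ}
    (ha : 0 ≤ a) (hb : 0 ≤ b) (hc : 0 ≤ c) (hd : 0 ≤ d) (hba : b ≤ a) (hca : c ≤ a) (hda : d ≤ a)
    (h : (ϱ * spinFlip ϱ).charpoly.roots =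
      ({a, b, c, d} : Multiset ℝ).map fun x : ℝ => ((x ^ 2 : ℝ) : ℂ)) :
    concurrence ϱ = max 0 (a - b - c - d) := by
  have hW : (woottersMatrix ϱ).PosSemidef :=
    Matrix.nonneg_iff_posSemidef.mp (CFC.sqrt_nonneg _)
  have heig := eigenvalues_eq_of_roots_charpoly_mul_self hW (m := {a, b, c, d})
    (by simp [ha, hb, hc, hd])
    (by rw [charpoly_woottersMatrix_mul_self hϱ (spinFlip_posSemidef hϱ), h])
  have h0 : Finset.univ.val.map (woottersEigenvalue ϱ) = {a, b, c, d} := by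
    rw [← heig]
    have e1 := hW.isHermitian.roots_charpoly_eq_eigenvalues
    rw [hW.isHermitian.roots_charpoly_eq_eigenvalues₀] at e1
    have e2 : Finset.univ.val.map hW.isHermitian.eigenvalues₀
        = Finset.univ.val.map hW.isHermitian.eigenvalues := by
      refine Multiset.map_injective Complex.ofReal_injective ?_
      rw [Multiset.map_map, Multiset.map_map]
      exact e1
    rw [← e2]
    have e3 : (Finset.univ : Finset (Fin (Fintype.card (Fin 2 × Fin 2)))).val
        = (Finset.univ : Finset (Fin 4)).val.map (Fin.cast (by simp)) := by
      have := Finset.map_univ_equiv (finCongr (show 4 = Fintype.card (Fin 2 × Fin 2) by simp))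
      rw [← this]
      rfl
    rw [e3, Multiset.map_map]
    rfl
  have hsum : ∑ i, woottersEigenvalue ϱ i = a + b + c + d := by
    have := congrArg Multiset.sum h0
    simp only [Multiset.insert_eq_cons, Multiset.sum_cons, Multiset.sum_singleton] at this
    rw [Finset.sum, this]
    ring
  have hle : woottersEigenvalue ϱ 0 ≤ a := by
    have : woottersEigenvalue ϱ 0 ∈ ({a, b, c, d} : Multiset ℝ) := by
      rw [← h0]
      exact Multiset.mem_map_of_mem _ (Finset.mem_univ (0 : Fin 4))
    simp only [Multiset.insert_eq_cons, Multiset.mem_cons, Multiset.mem_singleton] at this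
    rcases this with h | h | h | h <;> linarith
  have hge : a ≤ woottersEigenvalue ϱ 0 := by
    have : a ∈ Finset.univ.val.map (woottersEigenvalue ϱ) := by
      rw [h0]
      simp
    obtain ⟨i, -, hi⟩ := Multiset.mem_map.mp this
    rw [← hi]
    exact (woottersMatrix_isHermitian ϱ).eigenvalues₀_antitone (Fin.zero_le i)
  rw [Fin.sum_univ_four] at hsum
  rw [concurrence]
  congr 1
  linarith

/-! ### States of X shape -/

/-- The splitting of the computational basis into the even vectors `(i, i)` and the odd vectors
`(i, i + 1)`. -/
def parityEquiv : Fin 2 ⊕ Fin 2 ≃ Fin 2 × Fin 2 where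
  toFun := Sum.elim (fun i => (i, i)) (fun i => (i, i + 1))
  invFun x := if x.1 = x.2 then Sum.inl x.1 else Sum.inr x.1
  left_inv := by decide
  right_inv := by decide

/-- The operator that preserves parity and acts as `E` on the even and as `O` on the odd part. -/
def xOp (E O : Matrix (Fin 2) (Fin 2) ℂ) : TwoQubitOp :=
  Matrix.reindex parityEquiv parityEquiv (Matrix.fromBlocks E 0 0 O)

theorem xOp_mul (E O E' O' : Matrix (Fin 2) (Fin 2) ℂ) :
    xOp E O * xOp E' O' = xOp (E * E') (O * O') := by
  simp [xOp, Matrix.submatrix_mul_equiv, Matrix.fromBlocks_multiply]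

theorem spinFlip_xOp (a b c d a' b' c' d' : ℂ) :
    spinFlip (xOp !![a, b; c, d] !![a', b'; c', d']) =
      xOp !![star d, star c; star b, star a] !![star d', star c'; star b', star a'] := by
  ext ⟨i, j⟩ ⟨k, l⟩
  fin_cases i <;> fin_cases j <;> fin_cases k <;> fin_cases l <;>
    simp [spinFlip, xOp, parityEquiv, eps, Matrix.mul_apply, Fintype.sum_prod_type,
      Matrix.kroneckerMap_apply]

theorem partialTranspose_xOp (a b c d a' b' c' d' : ℂ) :
    partialTranspose (xOp !![a, b; c, d] !![a', b'; c', d']) =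
      xOp !![a, c'; b', d] !![a', c; b, d'] := by
  ext ⟨i, j⟩ ⟨k, l⟩
  fin_cases i <;> fin_cases j <;> fin_cases k <;> fin_cases l <;>
    simp [partialTranspose, xOp, parityEquiv]

theorem charpoly_fin_two_eq_mul {R : Type*} [CommRing R] [Nontrivial R]
    (M : Matrix (Fin 2) (Fin 2) R)
    {x y : R} (htr : M.trace = x + y) (hdet : M.det = x * y) :
    M.charpoly = (X - C x) * (X - C y) := by
  rw [Matrix.charpoly_fin_two, htr, hdet, C_add, C_mul]
  ring

theorem roots_charpoly_xOp {E O : Matrix (Fin 2) (Fin 2) ℂ} {x y x' y' : ℂ}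
    (htr : E.trace = x + y) (hdet : E.det = x * y)
    (htr' : O.trace = x' + y') (hdet' : O.det = x' * y') :
    (xOp E O).charpoly.roots = {x, y, x', y'} := by
  have h : (xOp E O).charpoly =
      (({x, y, x', y'} : Multiset ℂ).map fun a => X - C a).prod := by
    rw [xOp, Matrix.charpoly_reindex, Matrix.charpoly_fromBlocks_zero₁₂,
      charpoly_fin_two_eq_mul E htr hdet, charpoly_fin_two_eq_mul O htr' hdet']
    simp [mul_assoc]
  rw [h, Polynomial.roots_multiset_prod_X_sub_C]

/-! ### Local unitary equivalence -/


theorem su2_mul_eps_mul_transpose {U : Matrix (Fin 2) (Fin 2) ℂ}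
    (hU : U ∈ specialUnitaryGroup (Fin 2) ℂ) : U * eps * Uᵀ = eps := by
  have hd : U.det = 1 := (mem_specialUnitaryGroup_iff.mp hU).2
  rw [Matrix.det_fin_two] at hd
  ext i j
  fin_cases i <;> fin_cases j <;>
    simp [eps, Matrix.mul_apply, Fin.sum_univ_two] <;> grind

theorem su2_conjTranspose_mul_self {U : Matrix (Fin 2) (Fin 2) ℂ}
    (hU : U ∈ specialUnitaryGroup (Fin 2) ℂ) : Uᴴ * U = 1 :=
  mem_unitaryGroup_iff'.mp (mem_specialUnitaryGroup_iff.mp hU).1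

theorem su2_mul_eps {U : Matrix (Fin 2) (Fin 2) ℂ}
    (hU : U ∈ specialUnitaryGroup (Fin 2) ℂ) : U * eps = eps * U.map (starRingEnd ℂ) := by
  have h1 : Uᵀ * U.map (starRingEnd ℂ) = 1 := by
    have := congrArg Matrix.transpose (su2_conjTranspose_mul_self hU)
    rw [Matrix.transpose_mul, Matrix.transpose_one] at this
    exact this
  calc U * eps = U * eps * (Uᵀ * U.map (starRingEnd ℂ)) := by rw [h1, mul_one]
    _ = eps * U.map (starRingEnd ℂ) := by
      rw [← mul_assoc, su2_mul_eps_mul_transpose hU]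

theorem kronecker_conjTranspose_mul_self {U V : Matrix (Fin 2) (Fin 2) ℂ} (hU : Uᴴ * U = 1)
    (hV : Vᴴ * V = 1) : (Matrix.kronecker U V)ᴴ * Matrix.kronecker U V = 1 := by
  rw [Matrix.kronecker, Matrix.conjTranspose_kronecker, ← Matrix.mul_kronecker_mul, hU, hV,
    Matrix.one_kronecker_one]

theorem charpoly_unitary_conj {W : TwoQubitOp} (hW : Wᴴ * W = 1) (M : TwoQubitOp) :
    (W * M * Wᴴ).charpoly = M.charpoly := by
  rw [Matrix.charpoly_mul_comm, ← mul_assoc, hW, one_mul]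

/-- The spin flip commutes with conjugation by local operators of determinant one. -/
theorem spinFlip_local_conj {U V : Matrix (Fin 2) (Fin 2) ℂ}
    (hU : U ∈ specialUnitaryGroup (Fin 2) ℂ) (hV : V ∈ specialUnitaryGroup (Fin 2) ℂ)
    (ϱ : TwoQubitOp) :
    spinFlip (Matrix.kronecker U V * ϱ * (Matrix.kronecker U V)ᴴ) =
      Matrix.kronecker U V * spinFlip ϱ * (Matrix.kronecker U V)ᴴ := by
  have hW : Matrix.kronecker U V * Matrix.kronecker eps eps =
      Matrix.kronecker eps eps * (Matrix.kronecker U V).map (starRingEnd ℂ) := by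
    have hmap : (Matrix.kronecker U V).map (starRingEnd ℂ) =
        Matrix.kronecker (U.map (starRingEnd ℂ)) (V.map (starRingEnd ℂ)) := by
      ext
      simp [Matrix.kronecker]
    rw [hmap]
    simp only [Matrix.kronecker]
    rw [← Matrix.mul_kronecker_mul, su2_mul_eps hU, su2_mul_eps hV, Matrix.mul_kronecker_mul]
  have heps : (Matrix.kronecker eps eps).map (starRingEnd ℂ) = Matrix.kronecker eps eps := by
    ext ⟨i, j⟩ ⟨k, l⟩
    fin_cases i <;> fin_cases j <;> fin_cases k <;> fin_cases l <;> simp [eps]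
  have hflip (M : TwoQubitOp) : spinFlip M = Matrix.kronecker eps eps * M.map (starRingEnd ℂ) *
      (Matrix.kronecker eps eps)ᴴ := by
    have hH : ((Matrix.kronecker eps eps)ᴴ).map (starRingEnd ℂ) = (Matrix.kronecker eps eps)ᴴ := by
      conv_rhs => rw [← heps]
      rfl
    rw [spinFlip, Matrix.map_mul, Matrix.map_mul, heps, hH]
  have hWH : (Matrix.kronecker eps eps)ᴴ * (Matrix.kronecker U V)ᴴ =
      ((Matrix.kronecker U V)ᴴ).map (starRingEnd ℂ) * (Matrix.kronecker eps eps)ᴴ := by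
    rw [← Matrix.conjTranspose_mul, hW, Matrix.conjTranspose_mul]
    rfl
  rw [hflip, hflip, Matrix.map_mul, Matrix.map_mul]
  simp only [mul_assoc]
  rw [hWH]
  simp only [← mul_assoc]
  rw [hW]

/-- The partial transposition turns the first local factor into its entrywise conjugate. -/
theorem partialTranspose_local_conj (U V : Matrix (Fin 2) (Fin 2) ℂ) (ϱ : TwoQubitOp) :
    partialTranspose (Matrix.kronecker U V * ϱ * (Matrix.kronecker U V)ᴴ) =
      Matrix.kronecker (U.map (starRingEnd ℂ)) V * partialTranspose ϱ *
        (Matrix.kronecker (U.map (starRingEnd ℂ)) V)ᴴ := by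
  ext ⟨i, j⟩ ⟨k, l⟩
  simp [partialTranspose, Matrix.mul_apply, Fintype.sum_prod_type, Fin.sum_univ_two,
    Matrix.kroneckerMap_apply]
  ring

/-! ### Antisymmetric four-qubit vectors -/

/-- The four-qubit vector `(ε ⊗ A + B ⊗ ε) / 2`. For symmetric `A` and `B` these are exactly the
vectors that are antisymmetric in the two pairs of indices. -/
noncomputable def antisymVec (A B : Matrix (Fin 2) (Fin 2) ℂ) : FourQubitVec :=
  fun i j k l => 1 / 2 * (eps i k * A j l + B i k * eps j l)

/-- A four-qubit vector as a linear map from the second to the first pair of qubits. -/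
def amplitudeMatrix (ψ : FourQubitVec) : TwoQubitOp :=
  Matrix.of fun a b => ψ a.1 a.2 b.1 b.2

theorem reducedState_eq (ψ : FourQubitVec) :
    reducedState ψ = amplitudeMatrix ψ * (amplitudeMatrix ψ)ᴴ := by
  ext a b
  simp [reducedState, amplitudeMatrix, Matrix.mul_apply, Fintype.sum_prod_type]

open scoped ComplexOrder in
theorem reducedState_posSemidef (ψ : FourQubitVec) : (reducedState ψ).PosSemidef := by
  rw [reducedState_eq]
  exact Matrix.posSemidef_self_mul_conjTranspose _

theorem trace_reducedState (ψ : FourQubitVec) :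
    (reducedState ψ).trace = ((∑ i, ∑ j, ∑ k, ∑ l, ‖ψ i j k l‖ ^ 2 : ℝ) : ℂ) := by
  simp [Matrix.trace, reducedState, Fintype.sum_prod_type, Complex.mul_conj,
    Complex.normSq_eq_norm_sq]

theorem amplitudeMatrix_antisymVec (A B : Matrix (Fin 2) (Fin 2) ℂ) :
    amplitudeMatrix (antisymVec A B) =
      (1 / 2 : ℂ) • (Matrix.kronecker eps A + Matrix.kronecker B eps) := by
  ext a b
  simp [amplitudeMatrix, antisymVec, Matrix.kroneckerMap_apply]

/-- A local unitary of determinant one acts on the vector `(ε ⊗ A + B ⊗ ε) / 2` by congruence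
on `A` and `B`. -/
theorem reducedState_antisymVec_conj {U V : Matrix (Fin 2) (Fin 2) ℂ}
    (hU : U ∈ specialUnitaryGroup (Fin 2) ℂ) (hV : V ∈ specialUnitaryGroup (Fin 2) ℂ)
    (A B : Matrix (Fin 2) (Fin 2) ℂ) :
    reducedState (antisymVec (V * A * Vᵀ) (U * B * Uᵀ)) =
      Matrix.kronecker U V * reducedState (antisymVec A B) * (Matrix.kronecker U V)ᴴ := by
  have hP : amplitudeMatrix (antisymVec (V * A * Vᵀ) (U * B * Uᵀ)) =
      Matrix.kronecker U V * amplitudeMatrix (antisymVec A B) * (Matrix.kronecker U V)ᵀ := by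
    have ht : (Matrix.kronecker U V)ᵀ = Matrix.kronecker Uᵀ Vᵀ :=
      (Matrix.kroneckerMap_transpose _ U V).symm
    rw [amplitudeMatrix_antisymVec, amplitudeMatrix_antisymVec, ht]
    simp only [Matrix.kronecker, Matrix.mul_smul, Matrix.smul_mul, mul_add, add_mul,
      ← Matrix.mul_kronecker_mul, su2_mul_eps_mul_transpose hU,
      su2_mul_eps_mul_transpose hV]
  have hWt : (Matrix.kronecker U V)ᵀ * ((Matrix.kronecker U V)ᵀ)ᴴ = 1 := by
    have := congrArg Matrix.transpose (kronecker_conjTranspose_mul_self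
      (su2_conjTranspose_mul_self hU) (su2_conjTranspose_mul_self hV))
    rw [Matrix.transpose_mul, Matrix.transpose_one] at this
    exact this
  rw [reducedState_eq, reducedState_eq, hP]
  simp only [Matrix.conjTranspose_mul, mul_assoc]
  rw [← mul_assoc (Matrix.kronecker U V)ᵀ, hWt, one_mul]

/-! ### The canonical form -/

/-- The geometric mean of the diagonal entries of the even block of the canonical state, up to the
factor `1 / 4`. Exchanging `r` and `t` gives the odd block. -/
noncomputable def diagMean (p q r t : ℂ) : ℝ := √((‖p‖ ^ 2 + ‖r‖ ^ 2) * (‖q‖ ^ 2 + ‖t‖ ^ 2))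

/-- The off-diagonal entry of the odd block of the canonical state, up to the factor `1 / 4`.
Exchanging `r` and `t` gives the even block. -/
noncomputable def offDiag (p q r t : ℂ) : ℂ := p * star r + t * star q

/-- For diagonal `A` and `B` the reduced state has X shape, with Gram matrices as parity blocks. -/
theorem reducedState_canonical (p q r t : ℂ) :
    reducedState (antisymVec !![r, 0; 0, -t] !![p, 0; 0, -q]) =
      xOp !![(((‖p‖ ^ 2 + ‖r‖ ^ 2) / 4 : ℝ) : ℂ), offDiag p q t r / 4;
            star (offDiag p q t r) / 4, (((‖q‖ ^ 2 + ‖t‖ ^ 2) / 4 : ℝ) : ℂ)]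
          !![(((‖p‖ ^ 2 + ‖t‖ ^ 2) / 4 : ℝ) : ℂ), offDiag p q r t / 4;
            star (offDiag p q r t) / 4, (((‖q‖ ^ 2 + ‖r‖ ^ 2) / 4 : ℝ) : ℂ)] := by
  have hn (x : ℂ) : ((‖x‖ : ℝ) : ℂ) ^ 2 = x * (starRingEnd ℂ) x := (Complex.mul_conj' x).symm
  ext ⟨i, j⟩ ⟨k, l⟩
  fin_cases i <;> fin_cases j <;> fin_cases k <;> fin_cases l <;>
    simp [reducedState, antisymVec, eps, xOp, parityEquiv, offDiag, Fin.sum_univ_two, hn,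
      Complex.conj_ofNat] <;> ring

/-- The off-diagonal entry of either block is bounded, by Cauchy–Schwarz, by the geometric mean of
the diagonal of the other block. -/
theorem norm_offDiag_le (p q r t : ℂ) : ‖offDiag p q r t‖ ≤ diagMean p q t r := by
  refine Real.le_sqrt_of_sq_le ?_
  have h : ‖offDiag p q r t‖ ≤ ‖p‖ * ‖r‖ + ‖t‖ * ‖q‖ := by
    refine (norm_add_le _ _).trans (le_of_eq ?_)
    simp
  have h2 : ‖offDiag p q r t‖ ^ 2 ≤ (‖p‖ * ‖r‖ + ‖t‖ * ‖q‖) ^ 2 := by gcongr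
  nlinarith [sq_nonneg (‖p‖ * ‖q‖ - ‖t‖ * ‖r‖)]

/-- The inequality of arithmetic and geometric means; the right-hand side is `1` for normalized
states. -/
theorem diagMean_le (p q r t : ℂ) :
    diagMean p q r t ≤ (‖p‖ ^ 2 + ‖q‖ ^ 2 + ‖r‖ ^ 2 + ‖t‖ ^ 2) / 2 := by
  refine Real.sqrt_le_iff.mpr ⟨by positivity, ?_⟩
  nlinarith [sq_nonneg (‖p‖ ^ 2 + ‖r‖ ^ 2 - (‖q‖ ^ 2 + ‖t‖ ^ 2))]

theorem diagMean_nonneg (p q r t : ℂ) : 0 ≤ diagMean p q r t := Real.sqrt_nonneg _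

theorem diagMean_sq (p q r t : ℂ) :
    diagMean p q r t ^ 2 = (‖p‖ ^ 2 + ‖r‖ ^ 2) * (‖q‖ ^ 2 + ‖t‖ ^ 2) :=
  Real.sq_sqrt (by positivity)

/-- On each parity block the spin flip exchanges the two diagonal entries, so that the Wootters
eigenvalues of a state of X shape are `m ± |x|` with `m` the geometric mean of the diagonal. -/
theorem roots_charpoly_mul_spinFlip_xOp {a d a' d' m m' : ℝ} {x x' : ℂ} (hm : m ^ 2 = a * d)
    (hm' : m' ^ 2 = a' * d') :
    (xOp !![(a : ℂ), x; star x, (d : ℂ)] !![(a' : ℂ), x'; star x', (d' : ℂ)] *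
        spinFlip (xOp !![(a : ℂ), x; star x, (d : ℂ)]
          !![(a' : ℂ), x'; star x', (d' : ℂ)])).charpoly.roots =
      ({m + ‖x‖, m - ‖x‖, m' + ‖x'‖, m' - ‖x'‖} : Multiset ℝ).map
        fun y : ℝ => ((y ^ 2 : ℝ) : ℂ) := by
  have hmc : (m : ℂ) ^ 2 = a * d := by exact_mod_cast hm
  have hmc' : (m' : ℂ) ^ 2 = a' * d' := by exact_mod_cast hm'
  have h1 := Complex.mul_conj' x
  have h2 := Complex.mul_conj' x'
  rw [spinFlip_xOp, xOp_mul, roots_charpoly_xOp (x := (((m + ‖x‖) ^ 2 : ℝ) : ℂ))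
    (y := (((m - ‖x‖) ^ 2 : ℝ) : ℂ)) (x' := (((m' + ‖x'‖) ^ 2 : ℝ) : ℂ))
    (y' := (((m' - ‖x'‖) ^ 2 : ℝ) : ℂ))]
  · simp
  all_goals simp [Matrix.trace, Matrix.det_fin_two]
  · grind
  · grind
  · grind
  · grind

/-- The partial transposition exchanges the off-diagonal entries of the two parity blocks; the
eigenvalues are given for blocks of trace `1 / 2`. -/
theorem roots_charpoly_partialTranspose_xOp {a d a' d' s s' : ℝ} {x x' : ℂ}
    (had : a + d = 1 / 2) (had' : a' + d' = 1 / 2)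
    (hs : s ^ 2 = 1 + 16 * (‖x'‖ ^ 2 - a * d)) (hs' : s' ^ 2 = 1 + 16 * (‖x‖ ^ 2 - a' * d')) :
    (partialTranspose (xOp !![(a : ℂ), x; star x, (d : ℂ)]
          !![(a' : ℂ), x'; star x', (d' : ℂ)])).charpoly.roots =
      ({(1 + s) / 4, (1 - s) / 4, (1 + s') / 4, (1 - s') / 4} : Multiset ℝ).map
        fun y : ℝ => (y : ℂ) := by
  have hsc : (s : ℂ) ^ 2 = 1 + 16 * ((‖x'‖ : ℂ) ^ 2 - a * d) := by exact_mod_cast hs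
  have hsc' : (s' : ℂ) ^ 2 = 1 + 16 * ((‖x‖ : ℂ) ^ 2 - a' * d') := by exact_mod_cast hs'
  have hc : (a + d : ℂ) = 1 / 2 := by
    rw [← Complex.ofReal_add, had]; norm_num
  have hc' : (a' + d' : ℂ) = 1 / 2 := by
    rw [← Complex.ofReal_add, had']; norm_num
  have h1 := Complex.mul_conj' x
  have h2 := Complex.mul_conj' x'
  rw [partialTranspose_xOp, roots_charpoly_xOp (x := (((1 + s) / 4 : ℝ) : ℂ))
    (y := (((1 - s) / 4 : ℝ) : ℂ)) (x' := (((1 + s') / 4 : ℝ) : ℂ))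
    (y' := (((1 - s') / 4 : ℝ) : ℂ))]
  · simp
  all_goals simp [Matrix.trace, Matrix.det_fin_two]
  · grind
  · grind
  · grind
  · grind

theorem partialTranspose_isHermitian {ϱ : TwoQubitOp} (h : ϱ.IsHermitian) :
    (partialTranspose ϱ).IsHermitian := by
  ext a b
  exact congrFun (congrFun h (b.1, a.2)) (a.1, b.2)

theorem norm_sq_sum_eq_two_of_trace {p q r t : ℂ}
    (h : (reducedState (antisymVec !![r, 0; 0, -t] !![p, 0; 0, -q])).trace = 1) :
    ‖p‖ ^ 2 + ‖q‖ ^ 2 + ‖r‖ ^ 2 + ‖t‖ ^ 2 = 2 := by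
  rw [reducedState_canonical] at h
  simp only [Matrix.trace, Matrix.diag_apply, Fintype.sum_prod_type, Fin.sum_univ_two] at h
  simp [xOp, parityEquiv] at h
  have h' : (((‖p‖ ^ 2 + ‖q‖ ^ 2 + ‖r‖ ^ 2 + ‖t‖ ^ 2 : ℝ)) : ℂ) = ((2 : ℝ) : ℂ) := by
    push_cast
    linear_combination 2 * h
  exact_mod_cast h'

open scoped ComplexOrder in
/-- Concurrence and negativity of a state that is locally unitarily equivalent to the canonical
state with parameters `p, q, r, t`. -/
theorem measures_of_conj_eq_canonical {ϱ : TwoQubitOp} {U V : Matrix (Fin 2) (Fin 2) ℂ}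
    {p q r t : ℂ} (hpos : ϱ.PosSemidef)
    (hU : U ∈ specialUnitaryGroup (Fin 2) ℂ) (hV : V ∈ specialUnitaryGroup (Fin 2) ℂ)
    (h : Matrix.kronecker U V * ϱ * (Matrix.kronecker U V)ᴴ =
      reducedState (antisymVec !![r, 0; 0, -t] !![p, 0; 0, -q]))
    (hn : ‖p‖ ^ 2 + ‖q‖ ^ 2 + ‖r‖ ^ 2 + ‖t‖ ^ 2 = 2) :
    concurrence ϱ = 1 / 2 * max 0 (max (‖offDiag p q r t‖ - diagMean p q r t)
        (‖offDiag p q t r‖ - diagMean p q t r)) ∧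
      negativity ϱ = 1 / 2 * max 0 (max
        (√(1 + ‖offDiag p q r t‖ ^ 2 - diagMean p q r t ^ 2) - 1)
        (√(1 + ‖offDiag p q t r‖ ^ 2 - diagMean p q t r ^ 2) - 1)) := by
  have hU1 := su2_conjTranspose_mul_self hU
  have hV1 := su2_conjTranspose_mul_self hV
  have hW := kronecker_conjTranspose_mul_self hU1 hV1
  have hU2 : (U.map (starRingEnd ℂ))ᴴ * U.map (starRingEnd ℂ) = 1 := by
    -- the entrywise conjugate of a unitary matrix is unitary
    have := congrArg Matrix.transpose hU1
    rw [Matrix.transpose_mul, Matrix.transpose_one] at this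
    have e : (U.map (starRingEnd ℂ))ᴴ = Uᵀ := by
      ext
      simp
    rw [e]
    exact this
  have hW2 := kronecker_conjTranspose_mul_self hU2 hV1
  have hk := diagMean_nonneg p q r t
  have hk' := diagMean_nonneg p q t r
  have hk1 := diagMean_le p q r t
  have hk1' := diagMean_le p q t r
  have hok := norm_offDiag_le p q r t
  have hbk := norm_offDiag_le p q t r
  have hksq := diagMean_sq p q r t
  have hksq' := diagMean_sq p q t r
  have ho := norm_nonneg (offDiag p q r t)
  have hb := norm_nonneg (offDiag p q t r)
  have hcan := reducedState_canonical p q r t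
  have hst (x : ℂ) : star x / 4 = star (x / 4) := by simp
  rw [hst, hst] at hcan
  have hnd (x : ℂ) : ‖x / 4‖ = ‖x‖ / 4 := by simp
  set k := diagMean p q r t
  set k' := diagMean p q t r
  set x := offDiag p q r t
  set y := offDiag p q t r
  have hroots : (ϱ * spinFlip ϱ).charpoly.roots =
      ({k / 4 + ‖y‖ / 4, k / 4 - ‖y‖ / 4, k' / 4 + ‖x‖ / 4, k' / 4 - ‖x‖ / 4} : Multiset ℝ).map
        fun y : ℝ => ((y ^ 2 : ℝ) : ℂ) := by
    rw [← charpoly_unitary_conj hW]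
    have : Matrix.kronecker U V * (ϱ * spinFlip ϱ) * (Matrix.kronecker U V)ᴴ =
        (Matrix.kronecker U V * ϱ * (Matrix.kronecker U V)ᴴ) *
          spinFlip (Matrix.kronecker U V * ϱ * (Matrix.kronecker U V)ᴴ) := by
      rw [spinFlip_local_conj hU hV]
      simp only [mul_assoc]
      rw [← mul_assoc (Matrix.kronecker U V)ᴴ, hW, one_mul]
    rw [this, h, hcan, ← hnd, ← hnd]
    refine roots_charpoly_mul_spinFlip_xOp ?_ ?_
    · linear_combination hksq / 16
    · linear_combination hksq' / 16
  -- both radicands are nonnegative since the geometric means are at most one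
  have hs : 0 ≤ 1 + ‖x‖ ^ 2 - k ^ 2 := by nlinarith
  have hs' : 0 ≤ 1 + ‖y‖ ^ 2 - k' ^ 2 := by nlinarith
  have hroots' : (partialTranspose ϱ).charpoly.roots =
      ({(1 + √(1 + ‖x‖ ^ 2 - k ^ 2)) / 4, (1 - √(1 + ‖x‖ ^ 2 - k ^ 2)) / 4,
        (1 + √(1 + ‖y‖ ^ 2 - k' ^ 2)) / 4, (1 - √(1 + ‖y‖ ^ 2 - k' ^ 2)) / 4} : Multiset ℝ).map
        fun y : ℝ => (y : ℂ) := by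
    rw [← charpoly_unitary_conj hW2, ← partialTranspose_local_conj, h, hcan]
    refine roots_charpoly_partialTranspose_xOp ?_ ?_ ?_ ?_
    · linarith
    · linarith
    · rw [Real.sq_sqrt hs, hnd]
      linear_combination -hksq
    · rw [Real.sq_sqrt hs', hnd]
      linear_combination -hksq'
  constructor
  -- the largest Wootters eigenvalue is `(k' + ‖x‖) / 4` or `(k + ‖y‖) / 4`
  · rcases le_total (k + ‖y‖) (k' + ‖x‖) with hle | hle
    · rw [concurrence_eq_of_roots_charpoly hpos (a := k' / 4 + ‖x‖ / 4) (b := k' / 4 - ‖x‖ / 4)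
        (c := k / 4 + ‖y‖ / 4) (d := k / 4 - ‖y‖ / 4) (by linarith) (by linarith) (by linarith)
        (by linarith) (by linarith) (by linarith) (by linarith)
        (by
          rw [hroots]
          congr 1
          simp only [Multiset.insert_eq_cons, ← Multiset.singleton_add]
          abel)]
      rw [max_eq_left (a := ‖x‖ - k) (by linarith), mul_max_of_nonneg _ _ (by norm_num)]
      congr 1 <;> ring
    · rw [concurrence_eq_of_roots_charpoly hpos (by linarith) (by linarith) (by linarith)
        (by linarith) (by linarith) (by linarith) (by linarith) hroots]
      rw [max_eq_right (a := ‖x‖ - k) (by linarith), mul_max_of_nonneg _ _ (by norm_num)]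
      congr 1 <;> ring
  · rw [negativity, traceNorm_eq_of_roots_charpoly
      (partialTranspose_isHermitian hpos.isHermitian) hroots']
    simp only [Multiset.insert_eq_cons, Multiset.map_cons, Multiset.map_singleton,
      Multiset.sum_cons, Multiset.sum_singleton]
    have habs (s : ℝ) (h : 0 ≤ s) : |(1 + s) / 4| + |(1 - s) / 4| = 1 / 2 * (1 + max 0 (s - 1)) := by
      rw [abs_of_nonneg (by linarith : 0 ≤ (1 + s) / 4)]
      rcases le_total s 1 with h1 | h1
      · rw [abs_of_nonneg (by linarith), max_eq_left (by linarith)]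
        ring
      · rw [abs_of_nonpos (by linarith), max_eq_right (by linarith)]
        ring
    have e1 := habs _ (Real.sqrt_nonneg (1 + ‖x‖ ^ 2 - k ^ 2))
    have e2 := habs _ (Real.sqrt_nonneg (1 + ‖y‖ ^ 2 - k' ^ 2))
    -- at most one of the two blocks contributes a negative eigenvalue
    have key : max 0 (√(1 + ‖x‖ ^ 2 - k ^ 2) - 1) + max 0 (√(1 + ‖y‖ ^ 2 - k' ^ 2) - 1) =
        max 0 (max (√(1 + ‖x‖ ^ 2 - k ^ 2) - 1) (√(1 + ‖y‖ ^ 2 - k' ^ 2) - 1)) := by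
      have hle1 (u v : ℝ) (hu : 0 ≤ u) (huv : u ≤ v) : √(1 + u ^ 2 - v ^ 2) - 1 ≤ 0 := by
        have : √(1 + u ^ 2 - v ^ 2) ≤ 1 := Real.sqrt_le_one.mpr (by nlinarith)
        linarith
      rcases le_total ‖x‖ k with h1 | h1
      · have := hle1 ‖x‖ k ho h1
        rw [max_eq_left this, zero_add, ← max_assoc, max_eq_left this]
      · have := hle1 ‖y‖ k' hb (by linarith)
        rw [max_eq_left this, add_zero, max_comm (√(1 + ‖x‖ ^ 2 - k ^ 2) - 1), ← max_assoc,
          max_eq_left this]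
    linarith

/-- A complex symmetric `2 × 2` matrix becomes diagonal under congruence by a unitary of
determinant one. -/
theorem exists_su2_diagonal (B : Matrix (Fin 2) (Fin 2) ℂ) (hB : B 0 1 = B 1 0) :
    ∃ U ∈ specialUnitaryGroup (Fin 2) ℂ, ∃ a d : ℂ, U * B * Uᵀ = !![a, 0; 0, d] := by
  by_cases h0 : B 0 1 = 0
  · refine ⟨1, one_mem _, B 0 0, B 1 1, ?_⟩
    ext i j
    fin_cases i <;> fin_cases j <;> simp [h0, ← hB]
  -- the Bloch vector of the first row of `U` has to solve two real linear equations
  let f : (Fin 3 → ℝ) →ₗ[ℝ] ℂ :=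
    { toFun := fun n => -((n 0 : ℂ) + n 1 * Complex.I) * B 0 0 +
        ((n 0 : ℂ) - n 1 * Complex.I) * B 1 1 + 2 * n 2 * B 0 1
      map_add' := fun x y => by simp; ring
      map_smul' := fun c x => by simp; ring }
  obtain ⟨n, hn, hne⟩ := (Submodule.ne_bot_iff _).mp
    (f.ker_ne_bot_of_finrank_lt (by simp [Complex.finrank_real_complex]))
  have hf : -((n 0 : ℂ) + n 1 * Complex.I) * B 0 0 +
        ((n 0 : ℂ) - n 1 * Complex.I) * B 1 1 + 2 * n 2 * B 0 1 = 0 := hn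
  have hnn : 0 < n 0 ^ 2 + n 1 ^ 2 + n 2 ^ 2 := by
    by_contra hcon
    apply hne
    have h1 : n 0 = 0 := by nlinarith [sq_nonneg (n 0), sq_nonneg (n 1), sq_nonneg (n 2)]
    have h2 : n 1 = 0 := by nlinarith [sq_nonneg (n 0), sq_nonneg (n 1), sq_nonneg (n 2)]
    have h3 : n 2 = 0 := by nlinarith [sq_nonneg (n 0), sq_nonneg (n 1), sq_nonneg (n 2)]
    ext i
    fin_cases i <;> simp [h1, h2, h3]
  obtain ⟨N, hN, hNsq⟩ : ∃ N : ℝ, 0 < N ∧ N ^ 2 = n 0 ^ 2 + n 1 ^ 2 + n 2 ^ 2 :=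
    ⟨_, Real.sqrt_pos.mpr hnn, Real.sq_sqrt hnn.le⟩
  -- if the Bloch vector were `-e₃`, the equations would force `B 0 1 = 0`
  have hpos : 0 < N + n 2 := by
    by_contra hcon
    have h1 : n 0 = 0 := by nlinarith [sq_nonneg (n 0), sq_nonneg (n 1)]
    have h2 : n 1 = 0 := by nlinarith [sq_nonneg (n 0), sq_nonneg (n 1)]
    have h3 : n 2 ≠ 0 := by
      intro h3
      linarith
    apply h0
    simpa [h1, h2, h3] using hf
  obtain ⟨a, ha, hasq⟩ : ∃ a : ℝ, 0 < a ∧ a ^ 2 = (N + n 2) / (2 * N) :=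
    ⟨_, Real.sqrt_pos.mpr (by positivity), Real.sq_sqrt (by positivity)⟩
  obtain ⟨β, hβ⟩ : ∃ β : ℂ, β = ((n 0 : ℂ) - n 1 * Complex.I) / (2 * N * a) := ⟨_, rfl⟩
  have hNc : (N : ℂ) ≠ 0 := by exact_mod_cast hN.ne'
  have hac : (a : ℂ) ≠ 0 := by exact_mod_cast ha.ne'
  have h1 : (a : ℂ) * β = ((n 0 : ℂ) - n 1 * Complex.I) / (2 * N) := by
    rw [hβ]
    field_simp
  have h2 : (a : ℂ) * (starRingEnd ℂ) β = ((n 0 : ℂ) + n 1 * Complex.I) / (2 * N) := by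
    have := congrArg (starRingEnd ℂ) h1
    simpa [Complex.conj_ofNat] using this
  have hasqc : (a : ℂ) ^ 2 = (N + n 2) / (2 * N) := by exact_mod_cast hasq
  have hNsqc : (N : ℂ) ^ 2 = n 0 ^ 2 + n 1 ^ 2 + n 2 ^ 2 := by exact_mod_cast hNsq
  have h3 : β * (starRingEnd ℂ) β = (N - n 2) / (2 * N) := by
    have hNn : (N + n 2 : ℂ) ≠ 0 := by exact_mod_cast hpos.ne'
    have e : (a : ℂ) ^ 2 * (β * (starRingEnd ℂ) β) =
        ((n 0 : ℂ) - n 1 * Complex.I) / (2 * N) * (((n 0 : ℂ) + n 1 * Complex.I) / (2 * N)) := by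
      rw [← h1, ← h2]
      ring
    rw [hasqc] at e
    field_simp at e ⊢
    refine mul_left_cancel₀ hNn ?_
    linear_combination e - hNsqc - (n 1 : ℂ) ^ 2 * Complex.I_sq
  have hoff : (a : ℂ) * (B 0 0 * (-(starRingEnd ℂ) β) + B 0 1 * a) +
      β * (B 1 0 * (-(starRingEnd ℂ) β) + B 1 1 * a) = 0 := by
    rw [← hB]
    have hd : (a : ℂ) ^ 2 - β * (starRingEnd ℂ) β = n 2 / N := by
      rw [hasqc, h3]
      field_simp
      ring
    have : (a : ℂ) * (B 0 0 * (-(starRingEnd ℂ) β) + B 0 1 * a) +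
      β * (B 0 1 * (-(starRingEnd ℂ) β) + B 1 1 * a) =
      -(a * (starRingEnd ℂ) β) * B 0 0 + (a * β) * B 1 1 +
        ((a : ℂ) ^ 2 - β * (starRingEnd ℂ) β) * B 0 1 := by ring
    rw [this, hd, h1, h2]
    field_simp
    linear_combination hf
  have hone : (a : ℂ) ^ 2 + β * (starRingEnd ℂ) β = 1 := by
    rw [hasqc, h3]
    field_simp
    ring
  obtain ⟨U, hU⟩ : ∃ U : Matrix (Fin 2) (Fin 2) ℂ, U = !![(a : ℂ), β; -(starRingEnd ℂ) β, a] :=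
    ⟨_, rfl⟩
  refine ⟨U, ?_, (U * B * Uᵀ) 0 0, (U * B * Uᵀ) 1 1, ?_⟩
  · rw [mem_specialUnitaryGroup_iff, mem_unitaryGroup_iff, hU]
    constructor
    · ext i j
      fin_cases i <;> fin_cases j <;> simp [Matrix.mul_apply] <;>
        first | linear_combination hone | ring
    · rw [Matrix.det_fin_two]
      simp
      linear_combination hone
  · have e00 : U 0 0 = a := by rw [hU]; rfl
    have e01 : U 0 1 = β := by rw [hU]; rfl
    have e10 : U 1 0 = -(starRingEnd ℂ) β := by rw [hU]; rfl
    have e11 : U 1 1 = a := by rw [hU]; rfl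
    ext i j
    fin_cases i <;> fin_cases j
    · simp
    · simp [e00, e01, e10, e11, Matrix.mul_apply, Fin.sum_univ_two]
      linear_combination hoff
    · simp [e00, e01, e10, e11, Matrix.mul_apply, Fin.sum_univ_two]
      rw [← hB] at hoff ⊢
      linear_combination hoff
    · simp

/-- Concurrence and negativity of the reduced state of a normalized antisymmetric vector, together
with what the canonical parameters inherit from `A` and `B`. -/
theorem exists_canonical_measures {A B : Matrix (Fin 2) (Fin 2) ℂ} (hA : A 0 1 = A 1 0)
    (hB : B 0 1 = B 1 0) (htr : (reducedState (antisymVec A B)).trace = 1) :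
    ∃ p q r t : ℂ, ‖p‖ ^ 2 + ‖q‖ ^ 2 + ‖r‖ ^ 2 + ‖t‖ ^ 2 = 2 ∧
      (B = A → p = r ∧ q = t) ∧ (A.det = 0 → r * t = 0) ∧ (B.det = 0 → p * q = 0) ∧
      concurrence (reducedState (antisymVec A B)) =
        1 / 2 * max 0 (max (‖offDiag p q r t‖ - diagMean p q r t)
          (‖offDiag p q t r‖ - diagMean p q t r)) ∧
      negativity (reducedState (antisymVec A B)) = 1 / 2 * max 0 (max
        (√(1 + ‖offDiag p q r t‖ ^ 2 - diagMean p q r t ^ 2) - 1)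
        (√(1 + ‖offDiag p q t r‖ ^ 2 - diagMean p q t r ^ 2) - 1)) := by
  have hdiag : ∃ U ∈ specialUnitaryGroup (Fin 2) ℂ, ∃ V ∈ specialUnitaryGroup (Fin 2) ℂ,
      ∃ p q r t : ℂ, U * B * Uᵀ = !![p, 0; 0, -q] ∧ V * A * Vᵀ = !![r, 0; 0, -t] ∧
        (B = A → p = r ∧ q = t) := by
    obtain ⟨V, hV, r, t, hAV⟩ := exists_su2_diagonal A hA
    by_cases hBA : B = A
    -- the same unitary for both factors keeps the canonical parameters equal
    · exact ⟨V, hV, V, hV, r, -t, r, -t, by simp [hBA, hAV], by simp [hAV], by simp⟩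
    · obtain ⟨U, hU, p, q, hBU⟩ := exists_su2_diagonal B hB
      exact ⟨U, hU, V, hV, p, -q, r, -t, by simp [hBU], by simp [hAV], fun h => absurd h hBA⟩
  obtain ⟨U, hU, V, hV, p, q, r, t, hBU, hAV, hBA⟩ := hdiag
  have hconj := reducedState_antisymVec_conj hU hV A B
  rw [hBU, hAV] at hconj
  have htr' : (reducedState (antisymVec !![r, 0; 0, -t] !![p, 0; 0, -q])).trace = 1 := by
    rw [hconj, Matrix.trace_mul_comm, ← mul_assoc, kronecker_conjTranspose_mul_self
      (su2_conjTranspose_mul_self hU) (su2_conjTranspose_mul_self hV), one_mul, htr]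
  have hn := norm_sq_sum_eq_two_of_trace htr'
  have hdet {W M : Matrix (Fin 2) (Fin 2) ℂ} (hW : W ∈ specialUnitaryGroup (Fin 2) ℂ) {a d : ℂ}
      (h : W * M * Wᵀ = !![a, 0; 0, -d]) (hM : M.det = 0) : a * d = 0 := by
    have := congrArg Matrix.det h
    rw [Matrix.det_mul, Matrix.det_mul, hM, Matrix.det_fin_two] at this
    simpa using this
  exact ⟨p, q, r, t, hn, hBA, hdet hV hAV, hdet hU hBU,
    measures_of_conj_eq_canonical (reducedState_posSemidef _) hU hV hconj.symm hn⟩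

/-! ### Inequalities between the measures -/

/-- At most one of the two parity blocks contributes to concurrence and negativity. -/
theorem measures_trichotomy {k o k' b c n : ℝ} (ho : 0 ≤ o) (hb : 0 ≤ b) (hbk : b ≤ k)
    (hok : o ≤ k')
    (hc : c = 1 / 2 * max 0 (max (o - k) (b - k')))
    (hn : n = 1 / 2 * max 0 (max (√(1 + o ^ 2 - k ^ 2) - 1) (√(1 + b ^ 2 - k' ^ 2) - 1))) :
    (k ≤ o ∧ c = 1 / 2 * (o - k) ∧ n = 1 / 2 * (√(1 + o ^ 2 - k ^ 2) - 1)) ∨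
    (k' ≤ b ∧ c = 1 / 2 * (b - k') ∧ n = 1 / 2 * (√(1 + b ^ 2 - k' ^ 2) - 1)) ∨
    (c = 0 ∧ n = 0) := by
  have hle (u v : ℝ) (hu : 0 ≤ u) (huv : u ≤ v) : √(1 + u ^ 2 - v ^ 2) - 1 ≤ 0 := by
    have : √(1 + u ^ 2 - v ^ 2) ≤ 1 := Real.sqrt_le_one.mpr (by nlinarith)
    linarith
  have hge (u v : ℝ) (hv : 0 ≤ v) (hvu : v ≤ u) : 0 ≤ √(1 + u ^ 2 - v ^ 2) - 1 := by
    have : 1 ≤ √(1 + u ^ 2 - v ^ 2) := Real.one_le_sqrt.mpr (by nlinarith)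
    linarith
  rcases le_total k o with h1 | h1
  · have h2 := hle b k' hb (by linarith)
    have h3 := hge o k (hb.trans hbk) h1
    refine Or.inl ⟨h1, ?_, ?_⟩
    · rw [hc, max_eq_left (b := b - k') (by linarith), max_eq_right (by linarith)]
    · rw [hn, max_eq_left (h2.trans h3), max_eq_right h3]
  · have h2 := hle o k ho h1
    rcases le_total k' b with h4 | h4
    · have h3 := hge b k' (ho.trans hok) h4
      refine Or.inr (Or.inl ⟨h4, ?_, ?_⟩)
      · rw [hc, max_eq_right (a := o - k) (by linarith), max_eq_right (by linarith)]
      · rw [hn, max_eq_right (h2.trans h3), max_eq_right h3]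
    · refine Or.inr (Or.inr ⟨?_, ?_⟩)
      · rw [hc, max_eq_left (max_le (by linarith) (by linarith)), mul_zero]
      · rw [hn, max_eq_left (max_le h2 (hle b k' hb h4)), mul_zero]

theorem fermionicLower_zero : fermionicLower 0 = 0 := by simp [fermionicLower]

theorem fermionicUpper_zero : fermionicUpper 0 = 0 := by
  norm_num [fermionicUpper]

/-- The two bounds on the negativity for a parity block with `k ≤ o ≤ 1`. -/
theorem fermionic_bounds {k o : ℝ} (hk : 0 ≤ k) (hko : k ≤ o) (ho : o ≤ 1) :
    0 ≤ 1 / 2 * (o - k) ∧ 1 / 2 * (o - k) ≤ 1 / 2 ∧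
      fermionicLower (1 / 2 * (o - k)) ≤ 1 / 2 * (√(1 + o ^ 2 - k ^ 2) - 1) ∧
      1 / 2 * (√(1 + o ^ 2 - k ^ 2) - 1) ≤ fermionicUpper (1 / 2 * (o - k)) := by
  refine ⟨by linarith, by linarith, ?_, ?_⟩
  · unfold fermionicLower
    gcongr 1 / 2 * (√?_ - 1)
    nlinarith
  · unfold fermionicUpper
    gcongr 1 / 2 * (√?_ - 1)
    nlinarith [mul_nonneg (sub_nonneg.mpr hko) (sub_nonneg.mpr ho)]

/-- For `o = 1` the upper bound is attained. -/
theorem fermionicUpper_eq (k : ℝ) :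
    1 / 2 * (√(1 + 1 ^ 2 - k ^ 2) - 1) = fermionicUpper (1 / 2 * (1 - k)) := by
  unfold fermionicUpper
  congr 3
  ring

/-- For `k = 0` the lower bound is attained. -/
theorem fermionicLower_eq (o : ℝ) :
    1 / 2 * (√(1 + o ^ 2 - 0 ^ 2) - 1) = fermionicLower (1 / 2 * (o - 0)) := by
  unfold fermionicLower
  congr 3
  ring

theorem bounds_of_antisymVec {A B : Matrix (Fin 2) (Fin 2) ℂ} (hA : A 0 1 = A 1 0)
    (hB : B 0 1 = B 1 0) (htr : (reducedState (antisymVec A B)).trace = 1) :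
    0 ≤ concurrence (reducedState (antisymVec A B)) ∧
      concurrence (reducedState (antisymVec A B)) ≤ 1 / 2 ∧
      fermionicLower (concurrence (reducedState (antisymVec A B))) ≤
        negativity (reducedState (antisymVec A B)) ∧
      negativity (reducedState (antisymVec A B)) ≤
        fermionicUpper (concurrence (reducedState (antisymVec A B))) := by
  obtain ⟨p, q, r, t, hn, -, -, -, hC, hN⟩ := exists_canonical_measures hA hB htr
  have hok := norm_offDiag_le p q r t
  have hbk := norm_offDiag_le p q t r
  have hk := diagMean_le p q r t
  have hk' := diagMean_le p q t r
  rcases measures_trichotomy (norm_nonneg _) (norm_nonneg _) hbk hok hC hN with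
    ⟨h, h1, h2⟩ | ⟨h, h1, h2⟩ | ⟨h1, h2⟩
  · rw [h1, h2]
    exact fermionic_bounds (diagMean_nonneg _ _ _ _) h (by linarith)
  · rw [h1, h2]
    exact fermionic_bounds (diagMean_nonneg _ _ _ _) h (by linarith)
  · rw [h1, h2, fermionicLower_zero, fermionicUpper_zero]
    norm_num

theorem negativity_eq_fermionicUpper {A : Matrix (Fin 2) (Fin 2) ℂ} (hA : A 0 1 = A 1 0)
    (htr : (reducedState (antisymVec A A)).trace = 1) :
    negativity (reducedState (antisymVec A A)) =
      fermionicUpper (concurrence (reducedState (antisymVec A A))) := by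
  obtain ⟨p, q, r, t, hn, hAA, -, -, hC, hN⟩ := exists_canonical_measures hA hA htr
  obtain ⟨rfl, rfl⟩ := hAA rfl
  -- the off-diagonal entry is the norm of the vector
  have ho : ‖offDiag p q p q‖ = 1 := by
    have : offDiag p q p q = ((‖p‖ ^ 2 + ‖q‖ ^ 2 : ℝ) : ℂ) := by
      simp [offDiag, Complex.mul_conj, Complex.normSq_eq_norm_sq]
    rw [this, Complex.norm_real, Real.norm_of_nonneg (by positivity)]
    linarith
  have hok := norm_offDiag_le p q p q
  have hbk := norm_offDiag_le p q q p
  have hk := diagMean_le p q p q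
  rcases measures_trichotomy (norm_nonneg _) (norm_nonneg _) hbk hok hC hN with
    ⟨h, h1, h2⟩ | ⟨h, h1, h2⟩ | ⟨h1, h2⟩
  · rw [h1, h2, ho]
    exact fermionicUpper_eq _
  · have hb : ‖offDiag p q q p‖ = 1 := by linarith
    rw [h1, h2, hb]
    exact fermionicUpper_eq _
  · rw [h1, h2, fermionicUpper_zero]

theorem negativity_eq_fermionicLower {A B : Matrix (Fin 2) (Fin 2) ℂ} (hA : A 0 1 = A 1 0)
    (hB : B 0 1 = B 1 0) (hdA : A.det = 0) (hdB : B.det = 0)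
    (htr : (reducedState (antisymVec A B)).trace = 1) :
    negativity (reducedState (antisymVec A B)) =
      fermionicLower (concurrence (reducedState (antisymVec A B))) := by
  obtain ⟨p, q, r, t, hn, -, hrt, hpq, hC, hN⟩ := exists_canonical_measures hA hB htr
  have hk0 : diagMean p q r t = 0 ∨ diagMean p q t r = 0 := by
    rcases mul_eq_zero.mp (hpq hdB) with h | h <;> rcases mul_eq_zero.mp (hrt hdA) with h' | h' <;>
      simp [diagMean, h, h']
  have hok := norm_offDiag_le p q r t
  have hbk := norm_offDiag_le p q t r
  have ho := norm_nonneg (offDiag p q r t)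
  have hb := norm_nonneg (offDiag p q t r)
  rcases measures_trichotomy ho hb hbk hok hC hN with ⟨h, h1, h2⟩ | ⟨h, h1, h2⟩ | ⟨h1, h2⟩
  · have hk : diagMean p q r t = 0 := by
      rcases hk0 with h0 | h0
      · exact h0
      · exact le_antisymm (by linarith) (diagMean_nonneg _ _ _ _)
    rw [h1, h2, hk]
    exact fermionicLower_eq _
  · have hk : diagMean p q t r = 0 := by
      rcases hk0 with h0 | h0
      · exact le_antisymm (by linarith) (diagMean_nonneg _ _ _ _)
      · exact h0
    rw [h1, h2, hk]
    exact fermionicLower_eq _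
  · rw [h1, h2, fermionicLower_zero]

/-! ### Parametrization of the fermionic purifications -/

/-- The `6`-dimensional space of antisymmetric vectors is the sum of `ε ⊗ Sym²` and `Sym² ⊗ ε`. -/
theorem exists_antisymVec {ψ : FourQubitVec} (h : ∀ i j k l, ψ i j k l = -ψ k l i j) :
    ∃ A B : Matrix (Fin 2) (Fin 2) ℂ, A 0 1 = A 1 0 ∧ B 0 1 = B 1 0 ∧ ψ = antisymVec A B := by
  refine ⟨!![2 * ψ 0 0 1 0, ψ 0 0 1 1 + ψ 0 1 1 0; ψ 0 0 1 1 + ψ 0 1 1 0, 2 * ψ 0 1 1 1],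
    !![2 * ψ 0 0 0 1, ψ 0 0 1 1 - ψ 0 1 1 0; ψ 0 0 1 1 - ψ 0 1 1 0, 2 * ψ 1 0 1 1], rfl, rfl, ?_⟩
  have hz (i j) : ψ i j i j = 0 := self_eq_neg.mp (h i j i j)
  ext i j k l
  fin_cases i <;> fin_cases j <;> fin_cases k <;> fin_cases l <;>
    simp [antisymVec, eps, hz] <;> 
    first | done | exact h _ _ _ _ | ring1 | (rw [h]; ring1)

theorem norm_fermionicVec (w z : Fin 3 → ℂ) :
    ∑ i, ∑ j, ∑ k, ∑ l, ‖fermionicVec w z i j k l‖ ^ 2 =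
      (∑ i, ‖w i‖ ^ 2) + ∑ i, ‖z i‖ ^ 2 := by
  simp only [Fin.sum_univ_two, Fin.sum_univ_three, Complex.sq_norm, Complex.normSq_apply]
  simp [fermionicVec, eps, symMatrix]
  ring

theorem hasFermionicPurification_fermionicState {w z : Fin 3 → ℂ}
    (h : (∑ i, ‖w i‖ ^ 2) + (∑ i, ‖z i‖ ^ 2) = 1) :
    HasFermionicPurification (fermionicState w z) := by
  refine ⟨fermionicVec w z, fun i j k l => ?_, by rw [norm_fermionicVec, h], rfl⟩
  fin_cases i <;> fin_cases j <;> fin_cases k <;> fin_cases l <;>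
    simp [fermionicVec, eps, symMatrix] <;> ring

theorem fermionicState_eq (w z : Fin 3 → ℂ) :
    fermionicState w z = reducedState (antisymVec (symMatrix z) (symMatrix w)) := rfl

theorem trace_fermionicState {w z : Fin 3 → ℂ}
    (h : (∑ i, ‖w i‖ ^ 2) + (∑ i, ‖z i‖ ^ 2) = 1) : (fermionicState w z).trace = 1 := by
  rw [fermionicState, trace_reducedState, norm_fermionicVec, h, Complex.ofReal_one]

theorem det_symMatrix (z : Fin 3 → ℂ) : (symMatrix z).det = -∑ i, z i ^ 2 := by
  rw [Matrix.det_fin_two, Fin.sum_univ_three]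
  simp [symMatrix]
  linear_combination (z 1) ^ 2 * Complex.I_sq

/-! ### The two-parameter family -/

/-- Since the third component of `direction φ` vanishes, the state is already in canonical form. Only
`o - k = sin 2ϑ - cos φ` contributes, because `b ≤ k'` in the notation of the module comment. -/
theorem measures_twoParamState (ϑ φ : ℝ) (h0 : 0 ≤ ϑ) (h1 : ϑ ≤ Real.pi / 4)
    (h2 : 0 ≤ φ) (h3 : φ ≤ Real.pi / 2) :
    HasFermionicPurification (twoParamState ϑ φ) ∧
      concurrence (twoParamState ϑ φ) = 1 / 2 * max 0 (Real.sin (2 * ϑ) - Real.cos φ) ∧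
      negativity (twoParamState ϑ φ) =
        1 / 2 * max 0 (√(Real.sin (2 * ϑ) ^ 2 + Real.sin φ ^ 2) - 1) := by
  have hpi := Real.pi_pos
  have hcφ : 0 ≤ Real.cos φ := Real.cos_nonneg_of_mem_Icc ⟨by linarith, h3⟩
  have hsϑ : 0 ≤ Real.sin (2 * ϑ) := Real.sin_nonneg_of_nonneg_of_le_pi (by linarith) (by linarith)
  have hse : ((1 / √2 : ℝ)) ^ 2 = 1 / 2 := by
    rw [div_pow, Real.sq_sqrt (by norm_num), one_pow]
  have hnorm : (∑ i, ‖((Real.cos ϑ : ℂ) • direction φ) i‖ ^ 2) +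
      (∑ i, ‖((Real.sin ϑ : ℂ) • direction φ) i‖ ^ 2) = 1 := by
    have hd : ∑ i, ‖direction φ i‖ ^ 2 = 1 := by
      have hexp : ‖Complex.exp (φ * Complex.I)‖ = 1 := Complex.norm_exp_ofReal_mul_I φ
      have hh : ‖((1 / √2 : ℝ) : ℂ)‖ ^ 2 = 1 / 2 := by
        rw [Complex.norm_real, Real.norm_eq_abs, sq_abs, hse]
      simp only [direction, Fin.sum_univ_three, Pi.smul_apply, smul_eq_mul, norm_mul, mul_pow, hh]
      simp [hexp]
      norm_num
    simp only [Pi.smul_apply, smul_eq_mul, norm_mul, mul_pow, ← Finset.mul_sum, hd,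
      Complex.norm_real, Real.norm_eq_abs, sq_abs, mul_one]
    exact Real.cos_sq_add_sin_sq ϑ
  refine ⟨hasFermionicPurification_fermionicState hnorm, ?_⟩
  obtain ⟨f, hf⟩ : ∃ f : ℂ, f = direction φ 0 - Complex.I * direction φ 1 := ⟨_, rfl⟩
  obtain ⟨g, hg⟩ : ∃ g : ℂ, g = direction φ 0 + Complex.I * direction φ 1 := ⟨_, rfl⟩
  have hsym (c : ℝ) : symMatrix ((c : ℂ) • direction φ) = !![c * f, 0; 0, -(c * g)] := by
    rw [hf, hg]
    ext i j
    fin_cases i <;> fin_cases j <;> simp [symMatrix, direction] <;> ring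
  have hsc := Real.sin_sq_add_cos_sq φ
  have hscϑ := Real.sin_sq_add_cos_sq ϑ
  have hre : (Complex.exp (φ * Complex.I)).re = Real.cos φ := Complex.exp_ofReal_mul_I_re φ
  have him : (Complex.exp (φ * Complex.I)).im = Real.sin φ := Complex.exp_ofReal_mul_I_im φ
  have hfn : ‖f‖ ^ 2 = 1 + Real.sin φ := by
    have : f = ((1 / √2 : ℝ) : ℂ) * (1 - Complex.I * Complex.exp (φ * Complex.I)) := by
      rw [hf]
      simp [direction]
      ring
    rw [this, norm_mul, mul_pow, Complex.norm_real, Real.norm_eq_abs, sq_abs, hse,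
      Complex.sq_norm, Complex.normSq_apply]
    simp only [Complex.sub_re, Complex.sub_im, Complex.mul_re, Complex.mul_im, Complex.I_re,
      Complex.I_im, hre, him, Complex.one_re, Complex.one_im]
    linear_combination hsc / 2
  have hgn : ‖g‖ ^ 2 = 1 - Real.sin φ := by
    have : g = ((1 / √2 : ℝ) : ℂ) * (1 + Complex.I * Complex.exp (φ * Complex.I)) := by
      rw [hg]
      simp [direction]
      ring
    rw [this, norm_mul, mul_pow, Complex.norm_real, Real.norm_eq_abs, sq_abs, hse,
      Complex.sq_norm, Complex.normSq_apply]
    simp only [Complex.add_re, Complex.add_im, Complex.mul_re, Complex.mul_im, Complex.I_re,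
      Complex.I_im, hre, him, Complex.one_re, Complex.one_im]
    linear_combination hsc / 2
  have hnc (c : ℝ) (x : ℂ) : ‖(c : ℂ) * x‖ ^ 2 = c ^ 2 * ‖x‖ ^ 2 := by
    rw [norm_mul, mul_pow, Complex.norm_real, Real.norm_eq_abs, sq_abs]
  have hff : f * (starRingEnd ℂ) f = ((1 + Real.sin φ : ℝ) : ℂ) := by
    rw [Complex.mul_conj, Complex.normSq_eq_norm_sq, hfn]
  have hgg : g * (starRingEnd ℂ) g = ((1 - Real.sin φ : ℝ) : ℂ) := by
    rw [Complex.mul_conj, Complex.normSq_eq_norm_sq, hgn]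
  have hs2 : Real.sin (2 * ϑ) = 2 * Real.sin ϑ * Real.cos ϑ := Real.sin_two_mul ϑ
  obtain ⟨p, hp⟩ : ∃ p : ℂ, p = Real.cos ϑ * f := ⟨_, rfl⟩
  obtain ⟨q, hq⟩ : ∃ q : ℂ, q = Real.cos ϑ * g := ⟨_, rfl⟩
  obtain ⟨r, hr⟩ : ∃ r : ℂ, r = Real.sin ϑ * f := ⟨_, rfl⟩
  obtain ⟨t, ht⟩ : ∃ t : ℂ, t = Real.sin ϑ * g := ⟨_, rfl⟩
  have ho : ‖offDiag p q r t‖ = Real.sin (2 * ϑ) := by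
    have : offDiag p q r t = ((Real.sin (2 * ϑ) : ℝ) : ℂ) := by
      rw [hs2, offDiag, hp, hq, hr, ht]
      simp only [RCLike.star_def, map_mul, Complex.conj_ofReal]
      push_cast at hff hgg ⊢
      linear_combination (Complex.sin ϑ * Complex.cos ϑ) * (hff + hgg)
    rw [this, Complex.norm_real, Real.norm_of_nonneg hsϑ]
  have hk : diagMean p q r t = Real.cos φ := by
    rw [diagMean, ← Real.sqrt_sq hcφ, hp, hq, hr, ht]
    simp only [hnc, hfn, hgn]
    congr 1
    rw [← add_mul, ← add_mul, Real.cos_sq_add_sin_sq ϑ]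
    linear_combination -hsc
  have hbk : ‖offDiag p q t r‖ ≤ diagMean p q t r := by
    refine Real.le_sqrt_of_sq_le ?_
    have : offDiag p q t r = ((Real.sin (2 * ϑ) : ℝ) : ℂ) * (f * (starRingEnd ℂ) g) := by
      rw [hs2, offDiag, hp, hq, hr, ht]
      simp only [RCLike.star_def, map_mul, Complex.conj_ofReal]
      push_cast
      ring
    rw [this, hnc, norm_mul, mul_pow, Complex.norm_conj, hp, hq, hr, ht]
    simp only [hnc, hfn, hgn]
    rw [hs2]
    have hx : Real.sin φ ^ 2 ≤ 1 := Real.sin_sq_le_one φ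
    nlinarith [sq_nonneg (Real.cos ϑ ^ 2 - Real.sin ϑ ^ 2), hscϑ]
  have hstate : twoParamState ϑ φ =
      reducedState (antisymVec !![r, 0; 0, -t] !![p, 0; 0, -q]) := by
    rw [twoParamState, fermionicState_eq, hsym, hsym, hp, hq, hr, ht]
  have hn : ‖p‖ ^ 2 + ‖q‖ ^ 2 + ‖r‖ ^ 2 + ‖t‖ ^ 2 = 2 := by
    rw [hp, hq, hr, ht]
    simp only [hnc, hfn, hgn]
    linear_combination 2 * hscϑ
  obtain ⟨hC, hN⟩ := measures_of_conj_eq_canonical (ϱ := twoParamState ϑ φ)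
    (reducedState_posSemidef _)
    (one_mem _) (one_mem _)
    (by
      rw [hstate]
      simp [Matrix.kronecker]) hn
  have hb0 := norm_nonneg (offDiag p q t r)
  rw [hC, hN, ho, hk]
  constructor
  · rw [max_comm (Real.sin (2 * ϑ) - Real.cos φ), ← max_assoc,
      max_eq_left (a := (0 : ℝ)) (b := ‖offDiag p q t r‖ - diagMean p q t r) (by linarith)]
  · have hle : √(1 + ‖offDiag p q t r‖ ^ 2 - diagMean p q t r ^ 2) - 1 ≤ 0 := by
      have : √(1 + ‖offDiag p q t r‖ ^ 2 - diagMean p q t r ^ 2) ≤ 1 :=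
        Real.sqrt_le_one.mpr (by nlinarith)
      linarith
    rw [max_comm (√(1 + Real.sin (2 * ϑ) ^ 2 - Real.cos φ ^ 2) - 1), ← max_assoc,
      max_eq_left (a := (0 : ℝ)) hle]
    congr 5
    linear_combination -hsc

/-! ### Comparison with the general bounds -/

theorem generalLower_le_fermionicLower_iff (c : ℝ) :
    generalLower c ≤ fermionicLower c ↔
      2 * √((1 - c) ^ 2 + c ^ 2) ≤ √(1 + (2 * c) ^ 2) + (1 - 2 * c) := by
  unfold generalLower fermionicLower
  constructor <;> intro h <;> linarith

/-- Squaring shows that the comparison of the two lower bounds is governed by the sign of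
`(1 - 2c) (√(1 + 4c²) - 1)`. -/
theorem sq_sub_sq_lowers (c : ℝ) :
    (√(1 + (2 * c) ^ 2) + (1 - 2 * c)) ^ 2 - (2 * √((1 - c) ^ 2 + c ^ 2)) ^ 2 =
      2 * (1 - 2 * c) * (√(1 + (2 * c) ^ 2) - 1) := by
  have h1 : √((1 - c) ^ 2 + c ^ 2) ^ 2 = (1 - c) ^ 2 + c ^ 2 := Real.sq_sqrt (by positivity)
  have h2 : √(1 + (2 * c) ^ 2) ^ 2 = 1 + (2 * c) ^ 2 := Real.sq_sqrt (by positivity)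
  linear_combination h2 - 4 * h1

theorem one_le_sqrt_one_add (c : ℝ) : 1 ≤ √(1 + (2 * c) ^ 2) :=
  Real.one_le_sqrt.mpr (by nlinarith)

theorem one_lt_sqrt_one_add {c : ℝ} (hc : 0 < c) : 1 < √(1 + (2 * c) ^ 2) :=
  Real.lt_sqrt_of_sq_lt (by nlinarith)

theorem generalLower_le_fermionicLower {c : ℝ} (hc : c ≤ 1 / 2) :
    generalLower c ≤ fermionicLower c := by
  rw [generalLower_le_fermionicLower_iff]
  have h1 := one_le_sqrt_one_add c
  refine le_of_sq_le_sq ?_ (by linarith)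
  have := sq_sub_sq_lowers c
  nlinarith [mul_nonneg (by linarith : 0 ≤ 1 - 2 * c) (sub_nonneg.mpr h1)]

theorem generalLower_lt_fermionicLower {c : ℝ} (h0 : 0 < c) (hc : c < 1 / 2) :
    generalLower c < fermionicLower c := by
  have h1 := one_lt_sqrt_one_add h0
  have h2 : 2 * √((1 - c) ^ 2 + c ^ 2) < √(1 + (2 * c) ^ 2) + (1 - 2 * c) := by
    refine lt_of_pow_lt_pow_left₀ 2 (by linarith) ?_
    have := sq_sub_sq_lowers c
    nlinarith [mul_pos (by linarith : 0 < 1 - 2 * c) (sub_pos.mpr h1)]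
  unfold generalLower fermionicLower
  linarith

theorem le_half_of_generalLower_le_fermionicLower {c : ℝ}
    (h : generalLower c ≤ fermionicLower c) : c ≤ 1 / 2 := by
  rw [generalLower_le_fermionicLower_iff] at h
  by_contra! hc
  have h1 := one_lt_sqrt_one_add (c := c) (by linarith)
  have h2 := pow_le_pow_left₀ (by positivity) h 2
  have h3 := sq_sub_sq_lowers c
  nlinarith [mul_pos (by linarith : 0 < 2 * c - 1) (sub_pos.mpr h1)]

theorem fermionicUpper_le {c : ℝ} (h0 : 0 ≤ c) : fermionicUpper c ≤ c := by
  have : √(2 - (1 - 2 * c) ^ 2) ≤ 1 + 2 * c := Real.sqrt_le_iff.mpr ⟨by linarith, by nlinarith⟩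
  unfold fermionicUpper
  linarith

theorem fermionicUpper_lt {c : ℝ} (h0 : 0 < c) : fermionicUpper c < c := by
  have : √(2 - (1 - 2 * c) ^ 2) < 1 + 2 * c := (Real.sqrt_lt' (by linarith)).mpr (by nlinarith)
  unfold fermionicUpper
  linarith

/-! ### The two edges of the family -/

theorem concurrence_twoParamState_pi_div_four {φ : ℝ} (h0 : 0 ≤ φ) (h1 : φ ≤ Real.pi / 2) :
    concurrence (twoParamState (Real.pi / 4) φ) = 1 / 2 * (1 - Real.cos φ) := by
  have hpi := Real.pi_pos
  rw [(measures_twoParamState _ φ (by linarith) le_rfl h0 h1).2.1,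
    show 2 * (Real.pi / 4) = Real.pi / 2 by ring, Real.sin_pi_div_two,
    max_eq_right (sub_nonneg.mpr (Real.cos_le_one φ))]

theorem negativity_twoParamState_pi_div_four {φ : ℝ} (h0 : 0 ≤ φ) (h1 : φ ≤ Real.pi / 2) :
    negativity (twoParamState (Real.pi / 4) φ) =
      fermionicUpper (concurrence (twoParamState (Real.pi / 4) φ)) := by
  have hpi := Real.pi_pos
  have hge : 1 ≤ √(1 ^ 2 + Real.sin φ ^ 2) := Real.one_le_sqrt.mpr (by nlinarith)
  rw [concurrence_twoParamState_pi_div_four h0 h1,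
    (measures_twoParamState _ φ (by linarith) le_rfl h0 h1).2.2,
    show 2 * (Real.pi / 4) = Real.pi / 2 by ring, Real.sin_pi_div_two,
    max_eq_right (sub_nonneg.mpr hge), ← fermionicUpper_eq, Real.sin_sq]
  ring_nf

theorem concurrence_twoParamState_pi_div_two {ϑ : ℝ} (h0 : 0 ≤ ϑ) (h1 : ϑ ≤ Real.pi / 4) :
    concurrence (twoParamState ϑ (Real.pi / 2)) = 1 / 2 * Real.sin (2 * ϑ) := by
  have hpi := Real.pi_pos
  rw [(measures_twoParamState ϑ _ h0 h1 (by linarith) le_rfl).2.1, Real.cos_pi_div_two, sub_zero,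
    max_eq_right (Real.sin_nonneg_of_nonneg_of_le_pi (by linarith) (by linarith))]

theorem negativity_twoParamState_pi_div_two {ϑ : ℝ} (h0 : 0 ≤ ϑ) (h1 : ϑ ≤ Real.pi / 4) :
    negativity (twoParamState ϑ (Real.pi / 2)) =
      fermionicLower (concurrence (twoParamState ϑ (Real.pi / 2))) := by
  have hpi := Real.pi_pos
  have hge : 1 ≤ √(Real.sin (2 * ϑ) ^ 2 + 1 ^ 2) := Real.one_le_sqrt.mpr (by nlinarith)
  rw [concurrence_twoParamState_pi_div_two h0 h1,
    (measures_twoParamState ϑ _ h0 h1 (by linarith) le_rfl).2.2, Real.sin_pi_div_two,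
    max_eq_right (sub_nonneg.mpr hge), fermionicLower]
  ring_nf

theorem exists_concurrence_twoParamState_pi_div_four {c : ℝ} (h0 : 0 ≤ c) (h1 : c ≤ 1 / 2) :
    ∃ φ : ℝ, 0 ≤ φ ∧ φ ≤ Real.pi / 2 ∧ concurrence (twoParamState (Real.pi / 4) φ) = c := by
  have hφ0 := Real.arccos_nonneg (1 - 2 * c)
  have hφ1 : Real.arccos (1 - 2 * c) ≤ Real.pi / 2 :=
    Real.arccos_le_pi_div_two.mpr (by linarith)
  refine ⟨_, hφ0, hφ1, ?_⟩
  rw [concurrence_twoParamState_pi_div_four hφ0 hφ1,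
    Real.cos_arccos (by linarith) (by linarith)]
  ring

theorem exists_concurrence_twoParamState_pi_div_two {c : ℝ} (h0 : 0 ≤ c) (h1 : c ≤ 1 / 2) :
    ∃ ϑ : ℝ, 0 ≤ ϑ ∧ ϑ ≤ Real.pi / 4 ∧ concurrence (twoParamState ϑ (Real.pi / 2)) = c := by
  have hϑ0 : 0 ≤ Real.arcsin (2 * c) / 2 :=
    div_nonneg (Real.arcsin_nonneg.mpr (by linarith)) two_pos.le
  have hϑ1 : Real.arcsin (2 * c) / 2 ≤ Real.pi / 4 := by
    linarith [Real.arcsin_le_pi_div_two (2 * c)]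
  refine ⟨_, hϑ0, hϑ1, ?_⟩
  rw [concurrence_twoParamState_pi_div_two hϑ0 hϑ1, mul_div_cancel₀ _ two_ne_zero,
    Real.sin_arcsin (by linarith) (by linarith)]
  ring


end FermionicTwoQubit

theorem mainTheorem8 :
    -- the bounds for all two-qubit states with fermionic purification
    (∀ ϱ : TwoQubitOp, HasFermionicPurification ϱ →
      0 ≤ concurrence ϱ ∧ concurrence ϱ ≤ 1 / 2 ∧
      fermionicLower (concurrence ϱ) ≤ negativity ϱ ∧
      negativity ϱ ≤ fermionicUpper (concurrence ϱ)) ∧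
    -- comparison with the general two-qubit bounds
    (∀ c : ℝ, 0 ≤ c → c ≤ 1 / 2 →
      generalLower c ≤ fermionicLower c ∧ fermionicUpper c ≤ c) ∧
    (∀ c : ℝ, 0 < c → c < 1 / 2 → generalLower c < fermionicLower c) ∧
    (∀ c : ℝ, 0 < c → c ≤ 1 / 2 → fermionicUpper c < c) ∧
    (∀ c : ℝ, 0 ≤ c → c ≤ 1 → generalLower c ≤ fermionicLower c → c ≤ 1 / 2) ∧
    -- states saturating the bounds
    (∀ w z : Fin 3 → ℂ, (∑ i, ‖w i‖ ^ 2) + (∑ i, ‖z i‖ ^ 2) = 1 →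
      HasFermionicPurification (fermionicState w z) ∧
      (w = z → negativity (fermionicState w z) =
        fermionicUpper (concurrence (fermionicState w z))) ∧
      (∑ i, w i ^ 2 = 0 → ∑ i, z i ^ 2 = 0 → negativity (fermionicState w z) =
        fermionicLower (concurrence (fermionicState w z)))) ∧
    -- the explicit two-parameter subfamily, with its measures
    (∀ ϑ φ : ℝ, 0 ≤ ϑ → ϑ ≤ Real.pi / 4 → 0 ≤ φ → φ ≤ Real.pi / 2 →
      HasFermionicPurification (twoParamState ϑ φ) ∧
      concurrence (twoParamState ϑ φ) =
        1 / 2 * max 0 (Real.sin (2 * ϑ) - Real.cos φ) ∧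
      negativity (twoParamState ϑ φ) =
        1 / 2 * max 0 (√(Real.sin (2 * ϑ) ^ 2 + Real.sin φ ^ 2) - 1)) ∧
    -- its edges `ϑ = π / 4` and `φ = π / 2` lie on the upper and the lower boundary and run
    -- through all values of the concurrence
    (∀ φ : ℝ, 0 ≤ φ → φ ≤ Real.pi / 2 →
      negativity (twoParamState (Real.pi / 4) φ) =
        fermionicUpper (concurrence (twoParamState (Real.pi / 4) φ))) ∧
    (∀ c : ℝ, 0 ≤ c → c ≤ 1 / 2 →
      ∃ φ : ℝ, 0 ≤ φ ∧ φ ≤ Real.pi / 2 ∧ concurrence (twoParamState (Real.pi / 4) φ) = c) ∧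
    (∀ ϑ : ℝ, 0 ≤ ϑ → ϑ ≤ Real.pi / 4 →
      negativity (twoParamState ϑ (Real.pi / 2)) =
        fermionicLower (concurrence (twoParamState ϑ (Real.pi / 2)))) ∧
    (∀ c : ℝ, 0 ≤ c → c ≤ 1 / 2 →
      ∃ ϑ : ℝ, 0 ≤ ϑ ∧ ϑ ≤ Real.pi / 4 ∧
        concurrence (twoParamState ϑ (Real.pi / 2)) = c) := by 
  refine ⟨?_, fun c _ h1 => ⟨generalLower_le_fermionicLower h1, fermionicUpper_le ‹_›⟩,
    fun c h0 h1 => generalLower_lt_fermionicLower h0 h1, fun c h0 _ => fermionicUpper_lt h0,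
    fun c _ _ h => le_half_of_generalLower_le_fermionicLower h, ?_,
    measures_twoParamState,
    fun φ h0 h1 => negativity_twoParamState_pi_div_four h0 h1,
    fun c h0 h1 => exists_concurrence_twoParamState_pi_div_four h0 h1,
    fun ϑ h0 h1 => negativity_twoParamState_pi_div_two h0 h1,
    fun c h0 h1 => exists_concurrence_twoParamState_pi_div_two h0 h1⟩
  · rintro ϱ ⟨ψ, hanti, hnorm, rfl⟩
    have htr : (reducedState ψ).trace = 1 := by
      rw [trace_reducedState, hnorm, Complex.ofReal_one]
    obtain ⟨A, B, hA, hB, rfl⟩ := exists_antisymVec hanti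
    exact bounds_of_antisymVec hA hB htr
  · intro w z h
    have htr := trace_fermionicState h
    refine ⟨hasFermionicPurification_fermionicState h, ?_, ?_⟩
    · rintro rfl
      exact negativity_eq_fermionicUpper (A := symMatrix w) rfl htr
    · intro hw hz
      exact negativity_eq_fermionicLower (A := symMatrix z) (B := symMatrix w) rfl rfl
        (by rw [det_symMatrix, hz, neg_zero]) (by rw [det_symMatrix, hw, neg_zero]) htr
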